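/- Let $X$ be a real, infinite-dimensional Banach space that is uniformly convex and uniformly smooth, and let $T:X\to X$ be a compact linear operator with trivial kernel and dense range. *Classical eigenvalues.* Let $(\hat\lambda_n(T))_{n\ge 1}$ be the sequence of the nonzero eigenvalues of $T$ (that is, of its complexification acting on $X_{\mathbb C}=\mathbb C\otimes_{\mathbb R} X$), each repeated according to its algebraic multiplicity and arranged by decreasing modulus; if there are only finitely many of them, the sequence is continued by zeros. *$j$-eigenvalues.* For $x\in X$ with $\|x\|=1$ let $\tilde J x\in X^*$ be the gradient of the norm at $x$, i.e. the unique functional with $\|\tilde Jx\|=1$ and $\tilde Jx(x)=1$. For a compact injective linear operator $S:X\to X$ put $X_1=X$ and, recursively for $n\ge1$: $\lambda_n(S)=\|S|_{X_n}\|$; $x_n\in X_n$ is any vector with $\|x_n\|=1$ and $\|Sx_n\|=\lambda_n(S)$; and $X_{n+1}=\{z\in X:\ \tilde Jx_i(z)=0 \text{ for } i=1,\dots,n\}$. The numbers $\lambda_n(S)>0$ are the $j$-eigenvalues of $S$ (produced by the given choice of the vectors $x_n$). Then the sequence $(\hat\lambda_n(T))$ exists, the recursive scheme can be carried out for every power $S=T^k$,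 $k\ge1$, and, for every ordering of the classical eigenvalues and all choices made in the schemes for the operators $T^k$, $$|\hat\lambda_n(T)|=\lim_{k\to\infty}\lambda_n(T^k)^{1/k}\qquad\text{for every } n\in\mathbb N .$$ -/

import Mathlib

open Filter Topology
open scoped TensorProduct

/-- Uniform smoothness of a real normed space: the modulus of smoothness
`ρ(τ) = sup {(‖x + y‖ + ‖x - y‖) / 2 - 1 : ‖x‖ = 1, ‖y‖ = τ}` satisfies `ρ(τ) / τ → 0`
as `τ → 0`. -/
def IsUniformlySmooth (X : Type*) [NormedAddCommGroup X] [NormedSpace ℝ X] : Prop :=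
  ∀ ε : ℝ, 0 < ε → ∃ δ : ℝ, 0 < δ ∧ ∀ x : X, ‖x‖ = 1 → ∀ y : X, ‖y‖ ≤ δ →
    ‖x + y‖ + ‖x - y‖ ≤ 2 + ε * ‖y‖

/-- The gradient `grad ‖x‖` of the norm at `x`, an element of the dual space. In a uniformly
smooth space it exists for `x ≠ 0` and is the unique norm-one functional `f` with `f x = ‖x‖`
(see `hasFDerivAt_norm_of_isUniformlySmooth` and `eq_normGrad`). For `‖x‖ = 1` it is the value
at `x` of every duality map with a gauge function `γ` such that `γ 1 = 1`. -/
noncomputable def normGrad {X : Type*} [NormedAddCommGroup X] [NormedSpace ℝ X] (x : X) :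
    X →L[ℝ] ℝ :=
  fderiv ℝ (fun z : X => ‖z‖) x

/-- In a uniformly smooth space every norming functional of a unit vector is the
derivative of the norm there. -/
theorem hasFDerivAt_norm_of_isUniformlySmooth {X : Type*} [NormedAddCommGroup X]
    [NormedSpace ℝ X] (hX : IsUniformlySmooth X) {x : X} (hx : ‖x‖ = 1) {f : X →L[ℝ] ℝ}
    (hf : ‖f‖ = 1) (hfx : f x = ‖x‖) : HasFDerivAt (fun z : X => ‖z‖) f x := by
  have hle : ∀ z : X, f z ≤ ‖z‖ := fun z =>
    (le_abs_self _).trans (by simpa [hf] using f.le_opNorm z)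
  rw [hasFDerivAt_iff_isLittleO_nhds_zero, Asymptotics.isLittleO_iff]
  intro c hc
  obtain ⟨δ, hδ, h⟩ := hX c hc
  filter_upwards [Metric.closedBall_mem_nhds (0 : X) hδ] with y hy
  have hy' : ‖y‖ ≤ δ := by simpa using hy
  have h1 := h x hx y hy'
  have h2 := hle (x + y)
  have h3 := hle (x - y)
  simp only [map_add, map_sub, hfx] at h2 h3
  rw [Real.norm_eq_abs, abs_le]
  have h4 : 0 ≤ c * ‖y‖ := by positivity
  constructor <;> linarith

theorem eq_normGrad {X : Type*} [NormedAddCommGroup X] [NormedSpace ℝ X]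
    (hX : IsUniformlySmooth X) {x : X} (hx : ‖x‖ = 1) {f : X →L[ℝ] ℝ}
    (hf : ‖f‖ = 1) (hfx : f x = ‖x‖) : f = normGrad x :=
  (hasFDerivAt_norm_of_isUniformlySmooth hX hx hf hfx).fderiv.symm

theorem normGrad_spec {X : Type*} [NormedAddCommGroup X] [NormedSpace ℝ X]
    (hX : IsUniformlySmooth X) {x : X} (hx : ‖x‖ = 1) :
    ‖normGrad x‖ = 1 ∧ normGrad x x = ‖x‖ := by
  have hx0 : ‖x‖ ≠ 0 := by simp [hx]
  obtain ⟨f, hf, hfx⟩ := exists_dual_vector ℝ x hx0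
  have hfx1 : f x = ‖x‖ := by simpa using hfx
  rw [← eq_normGrad hX hx hf hfx1]
  exact ⟨hf, hfx1⟩

/-- The subspace of all `z` annihilated by the gradients of the norm at `x 0, …, x (n - 1)`;
it is the whole space for `n = 0`. -/
noncomputable def jSubspace {X : Type*} [NormedAddCommGroup X] [NormedSpace ℝ X] (x : ℕ → X)
    (n : ℕ) : Submodule ℝ X where
  carrier := {z | ∀ i, i < n → normGrad (x i) z = 0}
  add_mem' := fun ha hb i hi => by simp [ha i hi, hb i hi]
  zero_mem' := fun i _ => by simp
  smul_mem' := fun c _ ha i hi => by simp [ha i hi]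

/-- `x` and `lam` are sequences of `j`-eigenvectors and `j`-eigenvalues of `S`, as produced by the
(non-terminating) recursive scheme: `lam n` is the norm of the restriction of `S` to
the subspace determined by `x 0, …, x (n - 1)`, it is nonzero, and it is attained at the unit
vector `x n` of that subspace. Indices start at `0`. -/
structure IsJEigenSequence {X Y : Type*} [NormedAddCommGroup X] [NormedSpace ℝ X]
    [NormedAddCommGroup Y] [NormedSpace ℝ Y] (S : X →L[ℝ] Y) (x : ℕ → X) (lam : ℕ → ℝ) :
    Prop where
  norm_eq_one : ∀ n, ‖x n‖ = 1
  mem_jSubspace : ∀ n, x n ∈ jSubspace x n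
  eq_norm_restrict : ∀ n, lam n = ‖S.comp (jSubspace x n).subtypeL‖
  norm_apply : ∀ n, ‖S (x n)‖ = lam n
  ne_zero : ∀ n, lam n ≠ 0

/-- The complexification `T_ℂ` of `T`, acting on `X_ℂ = ℂ ⊗ X`. -/
noncomputable def complexification {X : Type*} [NormedAddCommGroup X] [NormedSpace ℝ X]
    (T : X →L[ℝ] X) : Module.End ℂ (ℂ ⊗[ℝ] X) :=
  (T : X →ₗ[ℝ] X).baseChange ℂ

/-- The algebraic multiplicity of the complex number `z` as an eigenvalue of `T`: the dimension of
the generalized eigenspace `⋃ m, ker (T_ℂ - z) ^ m` (it is `0` if `z` is no eigenvalue). -/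
noncomputable def algMultiplicity {X : Type*} [NormedAddCommGroup X] [NormedSpace ℝ X]
    (T : X →L[ℝ] X) (z : ℂ) : ℕ∞ :=
  Cardinal.toENat (Module.rank ℂ ((complexification T).maxGenEigenspace z))

/-- `μ` lists the eigenvalues of `T` by decreasing modulus: each nonzero complex number occurs
exactly as often as its algebraic multiplicity. The remaining terms, if any, are `0`. -/
structure IsEigenvalueSequence {X : Type*} [NormedAddCommGroup X] [NormedSpace ℝ X]
    (T : X →L[ℝ] X) (μ : ℕ → ℂ) : Prop where
  antitone_norm : Antitone fun n => ‖μ n‖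
  encard_eq : ∀ z : ℂ, z ≠ 0 → {n : ℕ | μ n = z}.encard = algMultiplicity T z

/-! ### The recursive scheme and the Euler equation for `j`-eigenvectors. -/

section JEigen

variable {X Y : Type*} [NormedAddCommGroup X] [NormedSpace ℝ X]
  [NormedAddCommGroup Y] [NormedSpace ℝ Y]

/-! For `s > 0` let `E` be the span of the generalized eigenspaces of the complexified operator `K`
with eigenvalues of modulus at least `s`. By compactness `dim E` is finite, and it counts the terms
of the eigenvalue sequence of modulus at least `s`. The powers `K ^ k` eventually expand `E` at any
rate below `s`, and map into `E` up to an error of any rate above `s`; both follow from Gelfand's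
formula, on `E` and on the quotient by `E`.

Lower bound: for `s = ‖μ n‖` the dimension exceeds `n`, so `E` contains a nonzero vector satisfying
the `n` linear conditions that define `jSubspace x n`; the expansion there bounds `lam k n` from
below (`IsJEigenSequence.le_of_forall_le_norm`).

Upper bound: for `s > ‖μ n‖` the dimension is at most `n`. By the Euler equation the normalised
images of `x 0, …, x n` form a triangular system, and `n + 1` such vectors cannot all lie near `E`;
so some `lam k i` with `i ≤ n`, and by monotonicity `lam k n`, is small
(`IsJEigenSequence.le_of_forall_exists_norm_sub_le`).

The constants depend only on `n` and disappear under `k`-th roots. -/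

theorem ContinuousLinearMap.norm_apply_le_norm_comp_subtypeL (S : X →L[ℝ] Y) (M : Submodule ℝ X)
    {u : X} (hu : u ∈ M) : ‖S u‖ ≤ ‖S.comp M.subtypeL‖ * ‖u‖ :=
  (S.comp M.subtypeL).le_opNorm ⟨u, hu⟩

/-- A compact operator on a uniformly convex Banach space attains its norm on every closed
subspace on which it does not vanish. -/
theorem IsCompactOperator.exists_norm_eq_norm_restrict [CompleteSpace X] [UniformConvexSpace X]
    {S : X →L[ℝ] Y} (hS : IsCompactOperator S) {M : Submodule ℝ X}
    (hM : IsClosed (M : Set X)) (h0 : ‖S.comp M.subtypeL‖ ≠ 0) :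
    ∃ u ∈ M, ‖u‖ = 1 ∧ ‖S u‖ = ‖S.comp M.subtypeL‖ := by
  set l := ‖S.comp M.subtypeL‖ with hl
  have hlpos : 0 < l := lt_of_le_of_ne (norm_nonneg (S.comp M.subtypeL)) h0.symm
  have hex : ∀ n : ℕ, ∃ u : X, u ∈ M ∧ ‖u‖ < 1 ∧ l - 1 / ((n : ℝ) + 1) < ‖S u‖ := by
    intro n
    have hlt : l - 1 / ((n : ℝ) + 1) < ‖S.comp M.subtypeL‖ := by
      have : 0 < 1 / ((n : ℝ) + 1) := by positivity
      linarith
    obtain ⟨v, hv1, hv2⟩ := (S.comp M.subtypeL).exists_lt_apply_of_lt_opNorm hlt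
    exact ⟨v, v.2, hv1, hv2⟩
  choose u huM hu1 hul using hex
  obtain ⟨C, hC, hSC⟩ := hS.image_closedBall_subset_compact (f := (S : X →ₗ[ℝ] Y)) 1
  obtain ⟨y, -, φ, hφ, hy⟩ := hC.tendsto_subseq (x := fun n => S (u n))
    (fun n => hSC ⟨u n, by simpa using (hu1 n).le, rfl⟩)
  have hly : l ≤ ‖y‖ := by
    have h1 : Tendsto (fun n : ℕ => l - 1 / ((φ n : ℝ) + 1)) atTop (𝓝 (l - 0)) :=
      tendsto_const_nhds.sub (tendsto_one_div_add_atTop_nhds_zero_nat.comp hφ.tendsto_atTop)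
    rw [sub_zero] at h1
    exact le_of_tendsto_of_tendsto' h1 hy.norm fun n => (hul (φ n)).le
  have hcauchy : CauchySeq (u ∘ φ) := by
    rw [Metric.cauchySeq_iff]
    intro ε hε
    obtain ⟨δ, hδ, h⟩ := exists_forall_closed_ball_dist_add_le_two_sub X hε
    -- Two terms at distance at least `ε` would have a sum of norm at most `2 - δ`, whose image
    -- loses `l * δ` against `2 * l`. Its distance to `2 • y` is less than twice `l * δ / 2`, while
    -- `‖y‖ ≥ l`.
    obtain ⟨N, hN⟩ := Metric.tendsto_atTop.1 hy (l * δ / 2) (by positivity)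
    refine ⟨N, fun m hm n hn => ?_⟩
    by_contra! hcon
    rw [dist_eq_norm] at hcon
    have h1 := h (hu1 (φ m)).le (hu1 (φ n)).le hcon
    have h2 := hN m hm
    have h3 := hN n hn
    simp only [Function.comp_apply, dist_eq_norm] at h2 h3
    have h4 := S.norm_apply_le_norm_comp_subtypeL M (M.add_mem (huM (φ m)) (huM (φ n)))
    have h5 : ‖S (u (φ m) + u (φ n))‖ ≤ l * (2 - δ) :=
      h4.trans (by gcongr)
    have h6 : ‖(2 : ℝ) • y‖ ≤ ‖S (u (φ m) + u (φ n))‖ + ‖S (u (φ m)) - y‖ + ‖S (u (φ n)) - y‖ := by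
      have : (2 : ℝ) • y = S (u (φ m) + u (φ n)) - (S (u (φ m)) - y) - (S (u (φ n)) - y) := by
        rw [map_add, two_smul]; abel
      rw [this]
      exact (norm_sub_le _ _).trans (add_le_add_left (norm_sub_le _ _) _)
    rw [norm_smul, Real.norm_ofNat] at h6
    nlinarith
  obtain ⟨w, hw⟩ := cauchySeq_tendsto_of_complete hcauchy
  have hwM : w ∈ M := hM.mem_of_tendsto hw (Eventually.of_forall fun n => huM (φ n))
  have hw1 : ‖w‖ ≤ 1 := le_of_tendsto' hw.norm fun n => (hu1 (φ n)).le
  have hSw : S w = y := tendsto_nhds_unique ((S.continuous.tendsto w).comp hw) hy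
  have h7 := S.norm_apply_le_norm_comp_subtypeL M hwM
  have hw2 : ‖w‖ = 1 := by
    refine le_antisymm hw1 ?_
    rw [hSw, ← hl] at h7
    by_contra! hlt
    nlinarith
  exact ⟨w, hwM, hw2, le_antisymm (by simpa [hw2] using h7) (by rwa [hSw])⟩

theorem mem_jSubspace_iff {x : ℕ → X} {n : ℕ} {z : X} :
    z ∈ jSubspace x n ↔ ∀ i, i < n → normGrad (x i) z = 0 := Iff.rfl

theorem isClosed_jSubspace (x : ℕ → X) (n : ℕ) : IsClosed (jSubspace x n : Set X) := by
  have : (jSubspace x n : Set X) = ⋂ i, ⋂ (_ : i < n), {z | normGrad (x i) z = 0} := by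
    ext z; simp [mem_jSubspace_iff]
  rw [this]
  exact isClosed_iInter fun i => isClosed_iInter fun _ =>
    isClosed_eq (normGrad (x i)).continuous continuous_const

theorem jSubspace_congr {x y : ℕ → X} {n : ℕ} (h : ∀ i, i < n → x i = y i) :
    jSubspace x n = jSubspace y n := by
  ext z
  simp only [mem_jSubspace_iff]
  exact forall₂_congr fun i hi => by rw [h i hi]

/-- Finitely many functionals cannot separate the points of an infinite-dimensional space; hence the
scheme never terminates. -/
theorem exists_ne_zero_mem_jSubspace (hdim : ¬ FiniteDimensional ℝ X) (x : ℕ → X) (n : ℕ) :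
    ∃ z ∈ jSubspace x n, z ≠ 0 := by
  by_contra! h
  refine hdim (FiniteDimensional.of_injective
    (LinearMap.pi fun i : Fin n => (normGrad (x i) : X →ₗ[ℝ] ℝ)) ?_)
  rw [← LinearMap.ker_eq_bot, LinearMap.ker_eq_bot']
  intro z hz
  exact h z fun i hi => congrFun hz ⟨i, hi⟩

theorem norm_restrict_jSubspace_ne_zero (hdim : ¬ FiniteDimensional ℝ X) {S : X →L[ℝ] Y}
    (hS : ∀ x, S x = 0 → x = 0) (x : ℕ → X) (n : ℕ) :
    ‖S.comp (jSubspace x n).subtypeL‖ ≠ 0 := by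
  obtain ⟨z, hz, hz0⟩ := exists_ne_zero_mem_jSubspace hdim x n
  intro h
  have := S.norm_apply_le_norm_comp_subtypeL _ hz
  rw [h, zero_mul] at this
  exact hz0 (hS z (norm_le_zero_iff.1 this))

/-- Recursive choice in which each step may depend on all earlier ones: condition `n` sees only the
entries up to `n`, so later updates do not disturb it. -/
theorem exists_seq_of_forall_update {α : Type*} [Nonempty α] {P : (ℕ → α) → ℕ → Prop}
    (hP : ∀ x y : ℕ → α, ∀ n, (∀ i, i ≤ n → x i = y i) → P x n → P y n)
    (h : ∀ x n, ∃ a, P (Function.update x n a) n) : ∃ x, ∀ n, P x n := by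
  choose v hv using h
  let f : ℕ → ℕ → α := fun n =>
    Nat.rec (fun _ => Classical.arbitrary α) (fun n g => Function.update g n (v g n)) n
  have hf : ∀ n, f (n + 1) = Function.update (f n) n (v (f n) n) := fun n => rfl
  have hstable : ∀ i m, i < m → f m i = f (i + 1) i := by
    intro i m him
    induction m, him using Nat.le_induction with
    | base => rfl
    | succ m hm ih => rw [hf, Function.update_of_ne (by omega), ih]
  refine ⟨fun n => f (n + 1) n, fun n => hP _ _ n (fun i hi => ?_) (hv (f n) n)⟩
  rw [← hf]
  exact hstable i (n + 1) (by omega)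

theorem exists_isJEigenSequence [CompleteSpace X] [UniformConvexSpace X]
    (hdim : ¬ FiniteDimensional ℝ X) {S : X →L[ℝ] Y} (hS : IsCompactOperator S)
    (hker : ∀ x, S x = 0 → x = 0) :
    ∃ (x : ℕ → X) (lam : ℕ → ℝ), IsJEigenSequence S x lam := by
  obtain ⟨x, hx⟩ := exists_seq_of_forall_update (α := X)
    (P := fun x n => x n ∈ jSubspace x n ∧ ‖x n‖ = 1 ∧
      ‖S (x n)‖ = ‖S.comp (jSubspace x n).subtypeL‖)
    (fun x y n hxy hx => by
      rw [← jSubspace_congr fun i hi => hxy i hi.le, ← hxy n le_rfl]; exact hx)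
    (fun x n => by
      obtain ⟨u, hu⟩ := hS.exists_norm_eq_norm_restrict (isClosed_jSubspace x n)
        (norm_restrict_jSubspace_ne_zero hdim hker x n)
      refine ⟨u, ?_⟩
      rw [Function.update_self, jSubspace_congr (x := Function.update x n u) (y := x)
        fun i hi => Function.update_of_ne hi.ne _ _]
      exact hu)
  exact ⟨x, fun n => ‖S.comp (jSubspace x n).subtypeL‖, fun n => (hx n).2.1, fun n => (hx n).1,
    fun n => rfl, fun n => (hx n).2.2, fun n => norm_restrict_jSubspace_ne_zero hdim hker x n⟩

theorem jSubspace_antitone (x : ℕ → X) : Antitone (jSubspace x) :=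
  fun _ _ h _ hz i hi => hz i (hi.trans_le h)

namespace IsJEigenSequence

variable {S : X →L[ℝ] Y} {x : ℕ → X} {lam : ℕ → ℝ}

theorem norm_apply_le (h : IsJEigenSequence S x lam) {n : ℕ} {z : X} (hz : z ∈ jSubspace x n) :
    ‖S z‖ ≤ lam n * ‖z‖ := by
  rw [h.eq_norm_restrict]
  exact S.norm_apply_le_norm_comp_subtypeL _ hz

theorem pos (h : IsJEigenSequence S x lam) (n : ℕ) : 0 < lam n :=
  lt_of_le_of_ne (by rw [← h.norm_apply]; exact norm_nonneg _) (h.ne_zero n).symm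

theorem antitone (h : IsJEigenSequence S x lam) : Antitone lam := by
  intro m n hmn
  have := h.norm_apply_le (jSubspace_antitone x hmn (h.mem_jSubspace n))
  rwa [h.norm_apply, h.norm_eq_one, mul_one] at this

/-- The Euler equation for the `j`-eigenvectors: a functional norming `S (x i)` vanishes on the
images of all subsequent `j`-eigenvectors. -/
theorem norming_apply_eq_zero (h : IsJEigenSequence S x lam) (hX : IsUniformlySmooth X)
    {i j : ℕ} (hij : i < j) {g : Y →L[ℝ] ℝ} (hg : ‖g‖ = 1) (hgx : g (S (x i)) = lam i) :
    g (S (x j)) = 0 := by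
  obtain ⟨hn1, hn2⟩ := normGrad_spec hX (h.norm_eq_one i)
  have hder := hasFDerivAt_norm_of_isUniformlySmooth hX (h.norm_eq_one i) hn1 hn2
  have h0 : normGrad (x i) (x j) = 0 := h.mem_jSubspace j i hij
  have hxj : x j ∈ jSubspace x i := jSubspace_antitone x hij.le (h.mem_jSubspace j)
  have hline : HasDerivAt (fun t : ℝ => x i + t • x j) (x j) 0 := by
    simpa using ((hasDerivAt_id (0 : ℝ)).smul_const (x j)).const_add (x i)
  have hd1 : HasDerivAt (fun t : ℝ => ‖x i + t • x j‖) (normGrad (x i) (x j)) 0 := by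
    have hder' : HasFDerivAt (fun z : X => ‖z‖) (normGrad (x i)) (x i + (0 : ℝ) • x j) := by
      simpa using hder
    exact hder'.comp_hasDerivAt (0 : ℝ) hline
  -- Since `x i + t • x j` stays in `jSubspace x i`, this function is nonnegative; it vanishes at `t
  -- = 0`, so its derivative there is zero.
  have hd2 : HasDerivAt (fun t : ℝ => lam i * ‖x i + t • x j‖ - (lam i + t * g (S (x j))))
      (lam i * normGrad (x i) (x j) - g (S (x j))) 0 := by
    have := (hd1.const_mul (lam i)).sub
      (((hasDerivAt_id (0 : ℝ)).mul_const (g (S (x j)))).const_add (lam i))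
    simpa using! this
  have hmin : IsLocalMin (fun t : ℝ => lam i * ‖x i + t • x j‖ - (lam i + t * g (S (x j)))) 0 := by
    refine Eventually.of_forall fun t => ?_
    have h1 : g (S (x i + t • x j)) ≤ ‖S (x i + t • x j)‖ :=
      (le_abs_self _).trans (by simpa [hg] using g.le_opNorm (S (x i + t • x j)))
    have h2 := h.norm_apply_le
      ((jSubspace x i).add_mem (h.mem_jSubspace i) ((jSubspace x i).smul_mem t hxj))
    have h3 : g (S (x i + t • x j)) = lam i + t * g (S (x j)) := by simp [hgx]
    simp only [zero_smul, add_zero, h.norm_eq_one, mul_one, zero_mul, sub_self]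
    linarith
  have := hmin.hasDerivAt_eq_zero hd2
  rw [h0, mul_zero, zero_sub, neg_eq_zero] at this
  exact this

/-- The normalised images of the `j`-eigenvectors form a triangular system with functionals of
norm one. -/
theorem exists_norming (h : IsJEigenSequence S x lam) (hX : IsUniformlySmooth X) (i : ℕ) :
    ∃ g : Y →L[ℝ] ℝ, ‖g‖ = 1 ∧ g (S (x i)) = lam i ∧ ∀ j, i < j → g (S (x j)) = 0 := by
  have h0 : ‖S (x i)‖ ≠ 0 := by rw [h.norm_apply]; exact h.ne_zero i
  obtain ⟨g, hg, hgx⟩ := exists_dual_vector ℝ (S (x i)) h0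
  have hgx' : g (S (x i)) = lam i := by rw [hgx, ← h.norm_apply]; rfl
  exact ⟨g, hg, hgx', fun j hij => h.norming_apply_eq_zero hX hij hg hgx'⟩

end IsJEigenSequence

end JEigen

/-! ### Algebra of generalized eigenspaces. -/

section OuterGenEigenspace

variable {V : Type*} [AddCommGroup V] [Module ℂ V]

/-- The span of all generalized eigenspaces of `f` for the eigenvalues of modulus at least `s`. -/
noncomputable def outerGenEigenspace (f : Module.End ℂ V) (s : ℝ) : Submodule ℂ V :=
  ⨆ z : {z : ℂ // s ≤ ‖z‖}, f.maxGenEigenspace z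

variable {f : Module.End ℂ V} {s : ℝ}

theorem maxGenEigenspace_le_outerGenEigenspace {z : ℂ} (hz : s ≤ ‖z‖) :
    f.maxGenEigenspace z ≤ outerGenEigenspace f s :=
  le_iSup (fun z : {z : ℂ // s ≤ ‖z‖} => f.maxGenEigenspace z) ⟨z, hz⟩

theorem apply_mem_outerGenEigenspace {v : V} (hv : v ∈ outerGenEigenspace f s) :
    f v ∈ outerGenEigenspace f s := by
  suffices outerGenEigenspace f s ≤ (outerGenEigenspace f s).comap f from this hv
  refine iSup_le fun z v hv => maxGenEigenspace_le_outerGenEigenspace z.2 ?_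
  exact f.mapsTo_maxGenEigenspace_of_comm (Commute.refl f) z hv

/-- On the generalized eigenspace of `w`, `f - z` is the nonzero scalar `w - z` plus a locally
nilpotent map. -/
theorem exists_sub_smul_eq_of_mem_maxGenEigenspace {z w : ℂ} (hzw : w ≠ z) {v : V}
    (hv : v ∈ f.maxGenEigenspace w) : ∃ u ∈ f.maxGenEigenspace w, f u - z • u = v := by
  obtain ⟨m, hm⟩ := (f.mem_maxGenEigenspace w v).1 hv
  induction m generalizing v with
  | zero =>
    have : v = 0 := by simpa using hm
    exact ⟨0, zero_mem _, by simp [this]⟩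
  | succ m ih =>
    have hm' : ((f - w • 1) ^ m) (f v - w • v) = 0 := by
      rw [pow_succ] at hm
      simpa using hm
    obtain ⟨u, hu, huv⟩ := ih ((f.mem_maxGenEigenspace w _).2 ⟨m, hm'⟩) hm'
    -- From `(f - w) v = (f - z) u` one gets `(w - z) v = (f - z) (v - u)`.
    refine ⟨(w - z)⁻¹ • (v - u), Submodule.smul_mem _ _ (Submodule.sub_mem _ hv hu), ?_⟩
    have h0 : w - z ≠ 0 := sub_ne_zero.2 hzw
    rw [map_smul, smul_comm z, ← smul_sub, inv_smul_eq_iff₀ h0, map_sub]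
    have : f u = f v - w • v + z • u := by rw [← huv]; abel
    rw [this]
    module

/-- This says that the map induced on the quotient has no eigenvalue `z` of modulus at least `s`. By
`key`, `f v - z • v` is `(f - z) u` up to a generalized eigenvector for `z`, with `u` in the span;
then `v - u` is itself a generalized eigenvector. -/
theorem mem_outerGenEigenspace_of_sub_smul_mem {z : ℂ} (hz : s ≤ ‖z‖) {v : V}
    (hv : f v - z • v ∈ outerGenEigenspace f s) : v ∈ outerGenEigenspace f s := by
  have key : ∀ w ∈ outerGenEigenspace f s,
      ∃ u ∈ outerGenEigenspace f s, w - (f u - z • u) ∈ f.maxGenEigenspace z := by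
    intro w hw
    refine Submodule.iSup_induction _ (motive := fun w => ∃ u ∈ outerGenEigenspace f s,
      w - (f u - z • u) ∈ f.maxGenEigenspace z) hw ?_ ?_ ?_
    · rintro ⟨y, hy⟩ w hw
      by_cases hyz : y = z
      · subst hyz
        exact ⟨0, zero_mem _, by simpa using hw⟩
      · obtain ⟨u, hu, huw⟩ := exists_sub_smul_eq_of_mem_maxGenEigenspace hyz hw
        exact ⟨u, maxGenEigenspace_le_outerGenEigenspace hy hu, by rw [huw, sub_self]; exact zero_mem _⟩
    · exact ⟨0, zero_mem _, by simp⟩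
    · rintro a b ⟨u, hu, hau⟩ ⟨u', hu', hbu⟩
      refine ⟨u + u', add_mem hu hu', ?_⟩
      have := add_mem hau hbu
      rw [map_add]
      convert this using 1
      module
  obtain ⟨u, hu, huv⟩ := key _ hv
  have h1 : v - u ∈ f.maxGenEigenspace z := by
    rw [f.mem_maxGenEigenspace] at huv ⊢
    obtain ⟨k, hk⟩ := huv
    refine ⟨k + 1, ?_⟩
    rw [pow_succ, Module.End.mul_apply]
    convert hk using 2
    simp only [LinearMap.sub_apply, LinearMap.smul_apply, Module.End.one_apply, map_sub]
  have h2 := add_mem (maxGenEigenspace_le_outerGenEigenspace hz h1) hu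
  rwa [sub_add_cancel] at h2

/-- Apply `f - z` repeatedly to a generalized eigenvector outside `W`; the last iterate before
entering `W` is the required vector. -/
theorem exists_sub_smul_mem_of_not_outerGenEigenspace_le {W : Submodule ℂ V}
    (hW : ¬ outerGenEigenspace f s ≤ W) : ∃ v ∉ W, ∃ z : ℂ, s ≤ ‖z‖ ∧ f v - z • v ∈ W := by
  obtain ⟨⟨z, hz⟩, hzW⟩ : ∃ z : {z : ℂ // s ≤ ‖z‖}, ¬ f.maxGenEigenspace z ≤ W := by
    by_contra! h
    exact hW (iSup_le h)
  obtain ⟨w, hw, hwW⟩ := SetLike.not_le_iff_exists.1 hzW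
  obtain ⟨k, hk⟩ := (f.mem_maxGenEigenspace z w).1 hw
  have hex : ∃ k : ℕ, ((f - z • 1) ^ k) w ∈ W := ⟨k, by rw [hk]; exact zero_mem _⟩
  classical
  obtain ⟨m, hm⟩ : ∃ m, Nat.find hex = m + 1 := by
    refine Nat.exists_eq_succ_of_ne_zero fun h0 => hwW ?_
    simpa [h0] using Nat.find_spec hex
  refine ⟨((f - z • 1) ^ m) w, Nat.find_min hex (by omega), z, hz, ?_⟩
  have := Nat.find_spec hex
  rw [hm, pow_succ'] at this
  simpa using this

theorem disjoint_maxGenEigenspace_outerGenEigenspace {z : ℂ} (hz : ‖z‖ < s) :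
    Disjoint (f.maxGenEigenspace z) (outerGenEigenspace f s) := by
  refine (f.independent_maxGenEigenspace z).mono_right (iSup_le fun w => ?_)
  exact le_iSup₂_of_le (w : ℂ) (fun h => by have := w.2; rw [h] at this; linarith) le_rfl

theorem eq_zero_of_mem_outerGenEigenspace {z : ℂ} (hz : ‖z‖ < s) {v : V}
    (hv : v ∈ outerGenEigenspace f s) (hfv : f v = z • v) : v = 0 := by
  refine Submodule.disjoint_def.1 (disjoint_maxGenEigenspace_outerGenEigenspace (f := f) hz) v
    ((f.mem_maxGenEigenspace z v).2 ⟨1, ?_⟩) hv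
  simp [hfv]

end OuterGenEigenspace

/-! ### Riesz theory and growth of powers of compact operators. -/

section Riesz

variable {Z : Type*} [NormedAddCommGroup Z] [NormedSpace ℂ Z]

theorem exists_norm_eq_one_sub_smul_mem {f : Module.End ℂ Z} {s : ℝ} {W : Submodule ℂ Z}
    [FiniteDimensional ℂ W] (hinv : ∀ w ∈ W, f w ∈ W) (hW : ¬ outerGenEigenspace f s ≤ W) :
    ∃ (x : Z) (z : ℂ), ‖x‖ = 1 ∧ s ≤ ‖z‖ ∧ f x - z • x ∈ W ∧ ∀ y ∈ W, 1 / 2 ≤ ‖x - y‖ := by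
  obtain ⟨v, hvW, z, hz, hv⟩ := exists_sub_smul_mem_of_not_outerGenEigenspace_le hW
  -- Riesz's lemma is applied inside `U`, because `f - z` sends all of `U` into `W`.
  set U : Submodule ℂ Z := W ⊔ Submodule.span ℂ {v}
  have hvU : v ∈ U := Submodule.mem_sup_right (Submodule.mem_span_singleton_self v)
  have hUz : ∀ u ∈ U, f u - z • u ∈ W := by
    intro u hu
    obtain ⟨w, hw, y, hy, rfl⟩ := Submodule.mem_sup.1 hu
    obtain ⟨c, rfl⟩ := Submodule.mem_span_singleton.1 hy
    have : f (w + c • v) - z • (w + c • v) = (f w - z • w) + c • (f v - z • v) := by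
      rw [map_add, map_smul]; module
    rw [this]
    exact add_mem (sub_mem (hinv w hw) (W.smul_mem z hw)) (W.smul_mem c hv)
  have hclosed : IsClosed ((W.comap U.subtype : Submodule ℂ U) : Set U) :=
    W.closed_of_finiteDimensional.preimage continuous_subtype_val
  obtain ⟨x₀, -, hx1, hx⟩ := riesz_lemma_of_lt_one (𝕜 := ℂ) hclosed ⟨⟨v, hvU⟩, hvW⟩
    (r := 1 / 2) (by norm_num)
  exact ⟨x₀, z, hx1, hz, hUz x₀ x₀.2, fun y hy =>
    hx ⟨y, (le_sup_left : W ≤ U) hy⟩ hy⟩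

/-- Compactness forces the eigenvalues away from zero to have finite total multiplicity. -/
theorem finiteDimensional_outerGenEigenspace {K : Z →L[ℂ] Z} (hK : IsCompactOperator K) {s : ℝ}
    (hs : 0 < s) : FiniteDimensional ℂ (outerGenEigenspace (K : Module.End ℂ Z) s) := by
  by_contra hfin
  set f : Module.End ℂ Z := (K : Module.End ℂ Z) with hf
  have hfK : ∀ x, f x = K x := fun x => rfl
  have hstep : ∀ W : {W : Submodule ℂ Z // FiniteDimensional ℂ W ∧ ∀ w ∈ W, f w ∈ W},
      ∃ (x : Z) (z : ℂ), ‖x‖ = 1 ∧ s ≤ ‖z‖ ∧ f x - z • x ∈ W.1 ∧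
        ∀ y ∈ W.1, 1 / 2 ≤ ‖x - y‖ := by
    rintro ⟨W, hWfin, hWinv⟩
    exact exists_norm_eq_one_sub_smul_mem hWinv
      fun hle => hfin (Submodule.finiteDimensional_of_le hle)
  choose x z hx1 hz hxz hx using hstep
  have hnext : ∀ W : {W : Submodule ℂ Z // FiniteDimensional ℂ W ∧ ∀ w ∈ W, f w ∈ W},
      ∃ W' : {W : Submodule ℂ Z // FiniteDimensional ℂ W ∧ ∀ w ∈ W, f w ∈ W},
        W.1 ≤ W'.1 ∧ x W ∈ W'.1 := by
    intro W
    have := W.2.1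
    refine ⟨⟨W.1 ⊔ Submodule.span ℂ {x W}, inferInstance, fun u hu => ?_⟩, le_sup_left,
      Submodule.mem_sup_right (Submodule.mem_span_singleton_self _)⟩
    obtain ⟨w, hw, y, hy, rfl⟩ := Submodule.mem_sup.1 hu
    obtain ⟨c, rfl⟩ := Submodule.mem_span_singleton.1 hy
    have h1 : f (w + c • x W) = (f w + c • (f (x W) - z W • x W)) + (c * z W) • x W := by
      rw [map_add, map_smul]; module
    rw [h1]
    exact add_mem (Submodule.mem_sup_left (add_mem (W.2.2 w hw) (W.1.smul_mem c (hxz W))))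
      (Submodule.mem_sup_right (Submodule.smul_mem _ _ (Submodule.mem_span_singleton_self _)))
  choose N hNle hNx using hnext
  -- An increasing chain of invariant subspaces, each obtained by adjoining the Riesz vector of its
  -- predecessor.
  let W : ℕ → {W : Submodule ℂ Z // FiniteDimensional ℂ W ∧ ∀ w ∈ W, f w ∈ W} :=
    fun n => N^[n] ⟨⊥, inferInstance, fun w hw => by simp [(Submodule.mem_bot ℂ).1 hw]⟩
  have hW : ∀ n, W (n + 1) = N (W n) := fun n => Function.iterate_succ_apply' N n _
  have hmono : Monotone fun n => (W n).1 := monotone_nat_of_le_succ fun n => by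
    simp only [hW]; exact hNle _
  have hsep : ∀ i j, i < j → s / 2 ≤ ‖K (x (W j)) - K (x (W i))‖ := by
    intro i j hij
    have h1 : x (W i) ∈ (W j).1 := by
      have : x (W i) ∈ (W (i + 1)).1 := by rw [hW]; exact hNx _
      exact hmono (Nat.succ_le_of_lt hij) this
    have h2 : f (x (W i)) - (f (x (W j)) - z (W j) • x (W j)) ∈ (W j).1 :=
      sub_mem ((W j).2.2 _ h1) (hxz _)
    have hzpos : 0 < ‖z (W j)‖ := hs.trans_le (hz _)
    have hz0 : z (W j) ≠ 0 := norm_pos_iff.1 hzpos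
    have h3 := hx (W j) _ ((W j).1.smul_mem (z (W j))⁻¹ h2)
    -- The subtracted vector lies in `W j`, so the bracket has norm at least `1 / 2`. The images are
    -- thus `s / 2`-separated, against compactness.
    have h4 : K (x (W j)) - K (x (W i)) = z (W j) • (x (W j) - (z (W j))⁻¹ •
        (f (x (W i)) - (f (x (W j)) - z (W j) • x (W j)))) := by
      rw [smul_sub, smul_inv_smul₀ hz0, hfK, hfK]; abel
    rw [h4, norm_smul]
    nlinarith [hz (W j)]
  obtain ⟨C, hC, hKC⟩ := hK.image_closedBall_subset_compact (f := (K : Z →ₗ[ℂ] Z)) 1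
  obtain ⟨y, -, φ, hφ, hy⟩ := hC.tendsto_subseq (x := fun n => K (x (W n)))
    (fun n => hKC ⟨x (W n), by simp [hx1], rfl⟩)
  obtain ⟨n, hn⟩ := Metric.cauchySeq_iff'.1 hy.cauchySeq (s / 2) (by positivity)
  have h5 := hn (n + 1) (Nat.le_succ n)
  rw [dist_eq_norm] at h5
  exact absurd (hsep _ _ (hφ (Nat.lt_succ_self n))) (not_le.2 h5)

theorem spectrum.eventually_norm_pow_le {A : Type*} [NormedRing A] [NormedAlgebra ℂ A] [CompleteSpace A]
    (a : A) {r r' : ℝ} (hr : 0 ≤ r) (hrr' : r < r') (h : ∀ z ∈ spectrum ℂ a, ‖z‖ ≤ r) :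
    ∀ᶠ k : ℕ in atTop, ‖a ^ k‖ ≤ r' ^ k := by
  have hrad : spectralRadius ℂ a < ENNReal.ofReal r' := by
    refine lt_of_le_of_lt (iSup₂_le fun z hz => ?_)
      ((ENNReal.ofReal_lt_ofReal_iff (hr.trans_lt hrr')).2 hrr')
    rw [← enorm_eq_nnnorm, ← ofReal_norm]
    exact ENNReal.ofReal_le_ofReal (h z hz)
  filter_upwards [(spectrum.pow_norm_pow_one_div_tendsto_nhds_spectralRadius a).eventually_lt_const
    hrad, eventually_ge_atTop 1] with k hk hk1
  have h1 : ‖a ^ k‖ ^ (1 / k : ℝ) < r' := (ENNReal.ofReal_lt_ofReal_iff (hr.trans_lt hrr')).1 hk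
  have hk0 : k ≠ 0 := by omega
  calc ‖a ^ k‖ = (‖a ^ k‖ ^ (1 / k : ℝ)) ^ k := by
        rw [one_div, Real.rpow_inv_natCast_pow (norm_nonneg _) hk0]
    _ ≤ r' ^ k := pow_le_pow_left₀ (by positivity) h1.le k

/-- The spectrum of the inverse of `R` lies in the disc of radius `s⁻¹`, so Gelfand's formula bounds
the powers of the inverse from above. -/
theorem eventually_pow_mul_norm_le_of_isUnit [CompleteSpace Z] {R : Z →L[ℂ] Z} {s s' : ℝ}
    (hs' : 0 < s') (hs : s' < s)
    (hunit : ∀ z : ℂ, ‖z‖ < s → IsUnit (algebraMap ℂ (Z →L[ℂ] Z) z - R)) :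
    ∀ᶠ k : ℕ in atTop, ∀ v : Z, s' ^ k * ‖v‖ ≤ ‖(R ^ k) v‖ := by
  have hs0 : 0 < s := hs'.trans hs
  have hRu : IsUnit R := by
    simpa using (hunit 0 (by simpa using hs0)).neg
  obtain ⟨u, rfl⟩ := hRu
  have hspec : ∀ z ∈ spectrum ℂ ((u⁻¹ : (Z →L[ℂ] Z)ˣ) : Z →L[ℂ] Z), ‖z‖ ≤ s⁻¹ := by
    intro z hz
    have hz0 : z ≠ 0 := spectrum.ne_zero_of_mem_of_unit hz
    have h1 : z⁻¹ ∈ spectrum ℂ (u : Z →L[ℂ] Z) := spectrum.inv₀_mem_iff.2 hz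
    by_contra! hlt
    refine h1 (hunit z⁻¹ ?_)
    rw [norm_inv]
    exact inv_lt_of_inv_lt₀ hs0 hlt
  filter_upwards [spectrum.eventually_norm_pow_le _ (inv_nonneg.2 hs0.le)
    (inv_strictAnti₀ hs' hs) hspec] with k hk v
  have h1 : (((u⁻¹ : (Z →L[ℂ] Z)ˣ) : Z →L[ℂ] Z) ^ k) (((u : Z →L[ℂ] Z) ^ k) v) = v := by
    rw [← mul_apply_eq_comp, ← Units.val_pow_eq_pow_val, ← Units.val_pow_eq_pow_val,
      ← Units.val_mul, inv_pow, inv_mul_cancel]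
    rfl
  have h2 : ‖v‖ ≤ (s'⁻¹) ^ k * ‖((u : Z →L[ℂ] Z) ^ k) v‖ := by
    conv_lhs => rw [← h1]
    exact (ContinuousLinearMap.le_opNorm _ _).trans
      (mul_le_mul_of_nonneg_right hk (norm_nonneg _))
  rw [inv_pow, inv_mul_eq_div, le_div_iff₀ (by positivity)] at h2
  linarith

/-- On the span of the generalized eigenspaces with eigenvalues of modulus at least `s`,
the powers of `K` are bounded below. -/
theorem eventually_pow_mul_norm_le {K : Z →L[ℂ] Z} {s s' : ℝ} (hs' : 0 < s') (hs : s' < s)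
    [FiniteDimensional ℂ (outerGenEigenspace (K : Module.End ℂ Z) s)] :
    ∀ᶠ k : ℕ in atTop, ∀ v ∈ outerGenEigenspace (K : Module.End ℂ Z) s,
      s' ^ k * ‖v‖ ≤ ‖(K ^ k) v‖ := by
  set E := outerGenEigenspace (K : Module.End ℂ Z) s
  have hmaps : ∀ v ∈ E, K v ∈ E := fun v hv => apply_mem_outerGenEigenspace hv
  have : CompleteSpace E := FiniteDimensional.complete ℂ E
  let R : E →L[ℂ] E := (K.comp E.subtypeL).codRestrict E fun v => hmaps v v.2
  have hR : ∀ v : E, ((R v : E) : Z) = K v := fun v => rfl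
  have hunit : ∀ z : ℂ, ‖z‖ < s → IsUnit (algebraMap ℂ (E →L[ℂ] E) z - R) := by
    intro z hz
    have hinj : Function.Injective (algebraMap ℂ (E →L[ℂ] E) z - R) := by
      rw [injective_iff_map_eq_zero]
      intro v hv
      have h1 : z • v - R v = 0 := by simpa [Algebra.algebraMap_eq_smul_one] using hv
      have h2 : K v = z • (v : Z) := by
        rw [← hR, ← sub_eq_zero.1 h1]; rfl
      exact Subtype.ext (eq_zero_of_mem_outerGenEigenspace (f := (K : Module.End ℂ Z)) hz v.2 h2)
    rw [ContinuousLinearMap.isUnit_iff_bijective]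
    exact ⟨hinj, LinearMap.injective_iff_surjective (f :=
      ((algebraMap ℂ (E →L[ℂ] E) z - R : E →L[ℂ] E) : E →ₗ[ℂ] E)).1 hinj⟩
  have hpow : ∀ k : ℕ, ∀ w : E, (((R ^ k) w : E) : Z) = (K ^ k) w := by
    intro k
    induction k with
    | zero => intro w; rfl
    | succ k ih => intro w; rw [pow_succ, pow_succ]; exact ih (R w)
  filter_upwards [eventually_pow_mul_norm_le_of_isUnit hs' hs hunit] with k hk v hv
  rw [← hpow k ⟨v, hv⟩]
  exact hk ⟨v, hv⟩

/-- Modulo the span of the generalized eigenspaces with eigenvalues of modulus at least `s`, the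
powers of a compact operator grow at most like those of `s`. -/
theorem eventually_exists_norm_pow_sub_le [CompleteSpace Z] {K : Z →L[ℂ] Z}
    (hK : IsCompactOperator K) {s s' : ℝ} (hs : 0 < s) (hs' : s < s') :
    ∀ᶠ k : ℕ in atTop, ∀ v : Z, ∃ e ∈ outerGenEigenspace (K : Module.End ℂ Z) s,
      ‖(K ^ k) v - e‖ ≤ 2 * s' ^ k * ‖v‖ := by
  set E := outerGenEigenspace (K : Module.End ℂ Z) s
  have : FiniteDimensional ℂ E := finiteDimensional_outerGenEigenspace hK hs
  have : IsClosed (E : Set Z) := E.closed_of_finiteDimensional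
  have hmaps : ∀ v ∈ E, K v ∈ E := fun v hv => apply_mem_outerGenEigenspace hv
  let Q : (Z ⧸ E) →L[ℂ] (Z ⧸ E) := E.liftQL (E.mkQL.comp K) fun v hv => by
    simpa using hmaps v hv
  have hQ : ∀ v, Q (E.mkQL v) = E.mkQL (K v) := fun v => rfl
  have hQc : IsCompactOperator Q := by
    obtain ⟨U, hU, C, hC, hUC⟩ := (isCompactOperator_iff_exists_mem_nhds_image_subset_compact _).1 hK
    refine (isCompactOperator_iff_exists_mem_nhds_image_subset_compact _).2
      ⟨E.mkQL '' U, ?_, E.mkQL '' C, hC.image E.mkQL.continuous, ?_⟩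
    · have := E.isOpenQuotientMap_mkQL.isOpenMap.image_mem_nhds hU
      rwa [map_zero] at this
    · rintro _ ⟨_, ⟨v, hv, rfl⟩, rfl⟩
      exact ⟨K v, hUC ⟨v, hv, rfl⟩, (hQ v).symm⟩
  -- Nonzero spectral values of the compact `Q` are eigenvalues, and an eigenvector modulo `E` with
  -- `‖z‖ ≥ s` would already lie in `E`.
  have hspec : ∀ z ∈ spectrum ℂ Q, ‖z‖ ≤ s := by
    intro z hz
    by_contra! hlt
    have hz0 : z ≠ 0 := norm_pos_iff.1 (hs.trans hlt)
    obtain ⟨q, hq⟩ := ((hQc.hasEigenvalue_iff_mem_spectrum hz0).2 hz).exists_hasEigenvector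
    obtain ⟨v, rfl⟩ := E.isOpenQuotientMap_mkQL.surjective q
    refine hq.2 ?_
    have h1 : E.mkQL (K v - z • v) = 0 := by
      rw [map_sub, map_smul, ← hQ, sub_eq_zero]
      exact hq.apply_eq_smul
    have h2 : K v - z • v ∈ E := (Submodule.Quotient.mk_eq_zero E).1 h1
    exact (Submodule.Quotient.mk_eq_zero E).2
      (mem_outerGenEigenspace_of_sub_smul_mem (f := (K : Module.End ℂ Z)) hlt.le h2)
  have hpow : ∀ k : ℕ, ∀ v : Z, (Q ^ k) (E.mkQL v) = E.mkQL ((K ^ k) v) := by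
    intro k
    induction k with
    | zero => intro v; rfl
    | succ k ih => intro v; rw [pow_succ, pow_succ]; exact ih (K v)
  filter_upwards [spectrum.eventually_norm_pow_le Q hs.le hs' hspec] with k hk v
  rcases eq_or_ne v 0 with rfl | hv
  · exact ⟨0, zero_mem _, by simp⟩
  -- The quotient norm is only an infimum; this positive slack for a near-optimal representative
  -- accounts for the factor `2`.
  have hpos : 0 < s' ^ k * ‖v‖ := mul_pos (pow_pos (hs.trans hs') k) (norm_pos_iff.2 hv)
  obtain ⟨m, hm, hmn⟩ := Submodule.Quotient.norm_mk_lt (E.mkQL ((K ^ k) v)) hpos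
  refine ⟨(K ^ k) v - m, (Submodule.Quotient.eq E).1 hm.symm, ?_⟩
  have h1 : ‖E.mkQL ((K ^ k) v)‖ ≤ s' ^ k * ‖v‖ := by
    rw [← hpow]
    refine ((Q ^ k).le_opNorm _).trans (mul_le_mul hk (Submodule.Quotient.norm_mk_le E v)
      (norm_nonneg _) (pow_nonneg (hs.trans hs').le k))
  rw [sub_sub_cancel]
  linarith

end Riesz

/-! ### Triangular systems stay away from low-dimensional subspaces. -/

section TriangularSystem

variable {Z : Type*} [NormedAddCommGroup Z] [NormedSpace ℂ Z]

/-- Applying `g m` to the full sum kills all terms after `m` and bounds `‖a m‖` by `C` times the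
norm of the full sum plus the earlier coefficients; a discrete Gronwall argument finishes. -/
theorem sum_norm_le_of_triangular {y : ℕ → Z} {g : ℕ → Z →ₗ[ℂ] ℂ} {C : ℝ} (hC : 0 ≤ C)
    (hg : ∀ i v, ‖g i v‖ ≤ C * ‖v‖) (hy : ∀ i, ‖y i‖ ≤ 1) (hone : ∀ i, g i (y i) = 1)
    (hzero : ∀ i j, i < j → g i (y j) = 0) (a : ℕ → ℂ) (n : ℕ) :
    ∑ i ∈ Finset.range n, ‖a i‖ ≤
      ((1 + C) ^ n - 1) * ‖∑ i ∈ Finset.range n, a i • y i‖ := by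
  set V := ‖∑ i ∈ Finset.range n, a i • y i‖
  suffices ∀ m ≤ n, ∑ i ∈ Finset.range m, ‖a i‖ ≤ ((1 + C) ^ m - 1) * V from this n le_rfl
  intro m
  induction m with
  | zero => simp
  | succ m ih =>
    intro hm
    have ih := ih (by omega)
    have h1 : g m (∑ i ∈ Finset.range n, a i • y i) =
        a m + ∑ i ∈ Finset.range m, a i * g m (y i) := by
      rw [map_sum, ← Finset.sum_subset (Finset.range_subset_range.2 hm), Finset.sum_range_succ,
        add_comm]
      · simp [hone]
      · intro i _ hi
        rw [map_smul, hzero m i (by simpa using hi), smul_zero]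
    have h2 : ‖a m‖ ≤ C * V + C * ∑ i ∈ Finset.range m, ‖a i‖ := by
      have h3 : a m = g m (∑ i ∈ Finset.range n, a i • y i) -
          ∑ i ∈ Finset.range m, a i * g m (y i) := by rw [h1]; ring
      rw [h3, Finset.mul_sum]
      refine (norm_sub_le _ _).trans (add_le_add (hg _ _) ((norm_sum_le _ _).trans ?_))
      refine Finset.sum_le_sum fun i _ => ?_
      rw [norm_mul, mul_comm C]
      refine mul_le_mul_of_nonneg_left ((hg m (y i)).trans ?_) (norm_nonneg _)
      simpa using mul_le_mul_of_nonneg_left (hy i) hC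
    rw [Finset.sum_range_succ, pow_succ]
    nlinarith

/-- A triangular system of more than `dim E` vectors cannot lie close to `E`. -/
theorem exists_forall_le_norm_sub_of_triangular {y : ℕ → Z} {g : ℕ → Z →ₗ[ℂ] ℂ} {C : ℝ}
    (hC : 0 ≤ C) (hg : ∀ i v, ‖g i v‖ ≤ C * ‖v‖) (hy : ∀ i, ‖y i‖ ≤ 1)
    (hone : ∀ i, g i (y i) = 1) (hzero : ∀ i j, i < j → g i (y j) = 0) {E : Submodule ℂ Z}
    [FiniteDimensional ℂ E] {n : ℕ} (hE : Module.finrank ℂ E ≤ n) :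
    ∃ i ≤ n, ∀ e ∈ E, ((1 + C) ^ (n + 1))⁻¹ ≤ ‖y i - e‖ := by
  by_contra! hcon
  have hcon' : ∀ i : Fin (n + 1), ∃ e : E, ‖y i - e‖ < ((1 + C) ^ (n + 1))⁻¹ := fun i => by
    obtain ⟨e, he, h⟩ := hcon i (by omega)
    exact ⟨⟨e, he⟩, h⟩
  choose e he using hcon'
  -- More than `dim E` approximants are dependent; with the coefficients of a relation the
  -- combination of the `y i` is too small for the triangular estimate.
  have hdep : ¬ LinearIndependent ℂ e := fun h => by
    have := h.fintype_card_le_finrank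
    rw [Fintype.card_fin] at this
    omega
  obtain ⟨b, hb, i₀, hi₀⟩ := Fintype.not_linearIndependent_iff.1 hdep
  let a : ℕ → ℂ := fun i => if h : i < n + 1 then b ⟨i, h⟩ else 0
  have ha : ∀ i : Fin (n + 1), a i = b i := fun i => dif_pos i.2
  have h1 := sum_norm_le_of_triangular hC hg hy hone hzero a (n + 1)
  rw [← Fin.sum_univ_eq_sum_range (fun i => ‖a i‖), ← Fin.sum_univ_eq_sum_range
    (fun i => a i • y i)] at h1
  simp only [ha] at h1
  set D := (1 + C) ^ (n + 1) with hD
  have hD1 : 1 ≤ D := one_le_pow₀ (by linarith)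
  have h2 : ‖∑ i : Fin (n + 1), b i • y i‖ ≤ D⁻¹ * ∑ i, ‖b i‖ := by
    have hb' : ∑ i, b i • (e i : Z) = 0 := by
      simpa using congrArg (Subtype.val : E → Z) hb
    have : ∑ i : Fin (n + 1), b i • y i = ∑ i : Fin (n + 1), b i • (y i - (e i : Z)) := by
      simp only [smul_sub, Finset.sum_sub_distrib, hb', sub_zero]
    rw [this, Finset.mul_sum]
    refine (norm_sum_le _ _).trans (Finset.sum_le_sum fun i _ => ?_)
    rw [norm_smul, mul_comm]
    exact mul_le_mul_of_nonneg_right (he i).le (norm_nonneg _)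
  have hpos : 0 < ∑ i, ‖b i‖ :=
    Finset.sum_pos' (fun i _ => norm_nonneg _) ⟨i₀, Finset.mem_univ _, norm_pos_iff.2 hi₀⟩
  have h3 : ∑ i, ‖b i‖ ≤ (D - 1) * (D⁻¹ * ∑ i, ‖b i‖) :=
    h1.trans (mul_le_mul_of_nonneg_left h2 (by linarith))
  have h4 : (D - 1) * (D⁻¹ * ∑ i, ‖b i‖) = ∑ i, ‖b i‖ - D⁻¹ * ∑ i, ‖b i‖ := by
    field_simp
  have h5 : 0 < D⁻¹ * ∑ i, ‖b i‖ := by positivity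
  linarith

end TriangularSystem

/-! ### Constant factors vanish under `k`-th roots. -/

section Limits

theorem tendsto_rpow_one_div_of_eventually_le {f : ℕ → ℝ} (hf : ∀ᶠ k in atTop, 0 ≤ f k) {r A : ℝ}
    (hr : 0 ≤ r) (hA : 0 < A) (hupper : ∀ s, r < s → ∀ᶠ k in atTop, f k ≤ A * s ^ k)
    (hlower : ∀ s, 0 < s → s < r → ∀ᶠ k in atTop, s ^ k ≤ A * f k) :
    Tendsto (fun k : ℕ => f k ^ (1 / (k : ℝ))) atTop (𝓝 r) := by
  have hroot : ∀ B : ℝ, 0 < B → Tendsto (fun k : ℕ => B ^ (1 / (k : ℝ))) atTop (𝓝 1) := by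
    intro B hB
    have := (tendsto_const_nhds (x := B)).rpow (tendsto_one_div_atTop_nhds_zero_nat (𝕜 := ℝ))
      (Or.inl hB.ne')
    simpa using this
  have hpow : ∀ s : ℝ, 0 ≤ s → ∀ k : ℕ, 1 ≤ k → (s ^ k) ^ (1 / (k : ℝ)) = s := by
    intro s hs k hk
    rw [one_div, Real.pow_rpow_inv_natCast hs (by omega)]
  rw [tendsto_order]
  refine ⟨fun a ha => ?_, fun a ha => ?_⟩
  -- Negative `a` is treated apart: for `r = 0` no `s` is available in `hlower`.
  · rcases lt_or_ge a 0 with ha0 | ha0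
    · filter_upwards [hf] with k hk
      exact ha0.trans_le (Real.rpow_nonneg hk _)
    obtain ⟨s, has, hsr⟩ := exists_between ha
    have hs0 : 0 < s := ha0.trans_lt has
    have hlim : Tendsto (fun k : ℕ => A⁻¹ ^ (1 / (k : ℝ)) * s) atTop (𝓝 (1 * s)) :=
      (hroot A⁻¹ (inv_pos.2 hA)).mul_const s
    rw [one_mul] at hlim
    filter_upwards [hlim.eventually_const_lt has, hlower s hs0 hsr, eventually_ge_atTop 1]
      with k h1 h2 hk
    refine h1.trans_le ?_
    rw [← hpow s hs0.le k hk, ← Real.mul_rpow (by positivity) (by positivity)]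
    refine Real.rpow_le_rpow (by positivity) ?_ (by positivity)
    rwa [inv_mul_le_iff₀ hA]
  · obtain ⟨s, hrs, hsa⟩ := exists_between ha
    have hs0 : 0 < s := hr.trans_lt hrs
    have hlim : Tendsto (fun k : ℕ => A ^ (1 / (k : ℝ)) * s) atTop (𝓝 (1 * s)) :=
      (hroot A hA).mul_const s
    rw [one_mul] at hlim
    filter_upwards [hlim.eventually_lt_const hsa, hupper s hrs, hf, eventually_ge_atTop 1]
      with k h1 h2 h3 hk
    refine lt_of_le_of_lt ?_ h1
    rw [← hpow s hs0.le k hk, ← Real.mul_rpow (by positivity) (by positivity)]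
    exact Real.rpow_le_rpow h3 h2 (by positivity)

end Limits

/-! ### Enumeration by decreasing size. -/

section Enumeration

/-- A family of positive numbers, finitely many of which exceed any given positive bound, can be
enumerated by decreasing size along an initial segment of `ℕ`. -/
theorem exists_decreasing_enumeration {ι : Type*} (N : ι → ℝ) (hpos : ∀ i, 0 < N i)
    (hfin : ∀ s, 0 < s → {i | s ≤ N i}.Finite) :
    ∃ r : ι → ℕ, Function.Injective r ∧ (∀ i j, r i ≤ r j → N j ≤ N i) ∧
      ∀ i m, m < r i → ∃ j, r j = m := by
  -- The strict predecessors of `i`, ties being broken by a well-order; the rank of `i` is their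
  -- number.
  let B : ι → Set ι := fun i => {j | N i < N j ∨ (N j = N i ∧ WellOrderingRel j i)}
  have hBfin : ∀ i, (B i).Finite := fun i => (hfin (N i) (hpos i)).subset fun j hj => by
    rcases hj with h | h
    · exact h.le
    · exact h.1.ge
  have hself : ∀ i, i ∉ B i := fun i hi => by
    rcases hi with h | h
    · exact lt_irrefl _ h
    · exact irrefl_of WellOrderingRel i h.2
  have htrans : ∀ i j, i ∈ B j → B i ⊆ B j := by
    rintro i j (h | ⟨h, h'⟩) k (hk | ⟨hk, hk'⟩)
    · exact Or.inl (h.trans hk)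
    · exact Or.inl (by rw [hk]; exact h)
    · exact Or.inl (by rw [← h]; exact hk)
    · exact Or.inr ⟨hk.trans h, trans_of WellOrderingRel hk' h'⟩
  have hlt : ∀ i j, i ∈ B j → (B i).ncard < (B j).ncard := fun i j h =>
    Set.ncard_lt_ncard ⟨htrans i j h, fun hle => hself i (hle h)⟩ (hBfin j)
  have htri : ∀ i j, i ∈ B j ∨ i = j ∨ j ∈ B i := by
    intro i j
    rcases lt_trichotomy (N i) (N j) with h | h | h
    · exact Or.inr (Or.inr (Or.inl h))
    · rcases trichotomous_of WellOrderingRel i j with h' | h' | h'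
      · exact Or.inl (Or.inr ⟨h, h'⟩)
      · exact Or.inr (Or.inl h')
      · exact Or.inr (Or.inr (Or.inr ⟨h.symm, h'⟩))
    · exact Or.inl (Or.inl h)
  have hinj : Function.Injective fun i => (B i).ncard := by
    intro i j hij
    rcases htri i j with h | h | h
    · exact absurd hij (hlt i j h).ne
    · exact h
    · exact absurd hij (hlt j i h).ne'
  refine ⟨fun i => (B i).ncard, hinj, fun i j hij => ?_, fun i m hm => ?_⟩
  · by_contra! h
    exact absurd (hlt j i (Or.inl h)) (not_lt.2 hij)
  · have himage : (fun j => (B j).ncard) '' B i = Set.Iio (B i).ncard := by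
      refine Set.eq_of_subset_of_ncard_le ?_ ?_ (Set.finite_Iio _)
      · rintro _ ⟨j, hj, rfl⟩
        exact hlt j i hj
      · rw [Set.ncard_image_of_injective _ hinj]
        simp
    obtain ⟨j, -, hj⟩ := himage.symm.subset hm
    exact ⟨j, hj⟩

end Enumeration

/-! ### A normed model of the complexification. -/

section NormedComplexification

/-- The complexification of a real normed space as a complex normed space: the real-linear maps
`f : ℂ → X`, where `f 1` is the real part, `-f I` is the imaginary part, and complex scalars act
by precomposition. -/
def NormedComplexification (X : Type*) [NormedAddCommGroup X] [NormedSpace ℝ X] : Type _ :=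
  ℂ →L[ℝ] X

namespace NormedComplexification

variable {X : Type*} [NormedAddCommGroup X] [NormedSpace ℝ X]

noncomputable instance : NormedAddCommGroup (NormedComplexification X) :=
  inferInstanceAs (NormedAddCommGroup (ℂ →L[ℝ] X))

instance [CompleteSpace X] : CompleteSpace (NormedComplexification X) :=
  inferInstanceAs (CompleteSpace (ℂ →L[ℝ] X))

noncomputable instance : FunLike (NormedComplexification X) ℂ X :=
  inferInstanceAs (FunLike (ℂ →L[ℝ] X) ℂ X)

noncomputable instance : ContinuousLinearMapClass (NormedComplexification X) ℝ ℂ X :=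
  inferInstanceAs (ContinuousLinearMapClass (ℂ →L[ℝ] X) ℝ ℂ X)

noncomputable instance : SMul ℂ (NormedComplexification X) where
  smul c f := ContinuousLinearMap.comp (f : ℂ →L[ℝ] X) (ContinuousLinearMap.mul ℝ ℂ c)

theorem smul_apply (c : ℂ) (f : NormedComplexification X) (z : ℂ) : (c • f) z = f (c * z) := rfl

theorem add_apply (f g : NormedComplexification X) (z : ℂ) : (f + g) z = f z + g z := rfl

theorem sub_apply (f g : NormedComplexification X) (z : ℂ) : (f - g) z = f z - g z := rfl

theorem zero_apply (z : ℂ) : (0 : NormedComplexification X) z = 0 := rfl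

@[ext]
theorem ext {f g : NormedComplexification X} (h : ∀ z, f z = g z) : f = g := DFunLike.ext _ _ h

theorem apply_eq (f : NormedComplexification X) (z : ℂ) :
    f z = z.re • f 1 + z.im • f Complex.I := by
  conv_lhs => rw [← Complex.re_add_im z]
  rw [map_add, ← map_smul, ← map_smul]
  simp [Complex.real_smul]

/-- The point of this model: submultiplicativity of the operator norm makes the norm compatible with
complex scalars. -/
noncomputable instance : NormedSpace ℂ (NormedComplexification X) where
  one_smul f := by ext z; simp [smul_apply]
  mul_smul a b f := by ext z; simp only [smul_apply]; congr 1; ring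
  smul_zero a := by ext z; rfl
  smul_add a f g := by ext z; rfl
  add_smul a b f := by ext z; simp only [smul_apply, add_apply, add_mul, map_add]
  zero_smul f := by ext z; simp only [smul_apply, zero_mul, map_zero, zero_apply]
  norm_smul_le c f := by
    refine (ContinuousLinearMap.opNorm_comp_le (f : ℂ →L[ℝ] X)
      (ContinuousLinearMap.mul ℝ ℂ c)).trans ?_
    rw [mul_comm]
    exact mul_le_mul_of_nonneg_right (ContinuousLinearMap.opNorm_mul_apply_le ℝ ℂ c)
      (norm_nonneg _)

theorem real_smul_apply (r : ℝ) (f : NormedComplexification X) (z : ℂ) :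
    (r • f) z = r • f z := by
  rw [← map_smul f, Complex.real_smul]
  rfl

theorem norm_apply_le (f : NormedComplexification X) (z : ℂ) : ‖f z‖ ≤ ‖f‖ * ‖z‖ :=
  ContinuousLinearMap.le_opNorm (f : ℂ →L[ℝ] X) z

theorem norm_le_add (f : NormedComplexification X) : ‖f‖ ≤ ‖f 1‖ + ‖f Complex.I‖ := by
  refine ContinuousLinearMap.opNorm_le_bound (f : ℂ →L[ℝ] X) (by positivity) fun z => ?_
  change ‖f z‖ ≤ _
  rw [apply_eq, add_mul]
  refine (norm_add_le _ _).trans (add_le_add ?_ ?_)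
  · rw [norm_smul, mul_comm]
    exact mul_le_mul_of_nonneg_left (Complex.abs_re_le_norm z) (norm_nonneg _)
  · rw [norm_smul, mul_comm]
    exact mul_le_mul_of_nonneg_left (Complex.abs_im_le_norm z) (norm_nonneg _)

/-- The embedding of a real space into its complexification. -/
noncomputable def ofReal : X →ₗ[ℝ] NormedComplexification X where
  toFun x := Complex.reCLM.smulRight x
  map_add' x y := by
    ext z
    exact smul_add _ _ _
  map_smul' r x := by
    ext z
    refine Eq.trans ?_ (real_smul_apply r _ z).symm
    exact smul_comm z.re r x

theorem ofReal_apply (x : X) (z : ℂ) : ofReal x z = z.re • x := rfl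

theorem norm_ofReal (x : X) : ‖ofReal x‖ = ‖x‖ := by
  refine le_antisymm ((norm_le_add _).trans (by simp [ofReal_apply])) ?_
  simpa [ofReal_apply] using norm_apply_le (ofReal x) 1

theorem eq_ofReal_sub (f : NormedComplexification X) :
    f = ofReal (f 1) - Complex.I • ofReal (f Complex.I) := by
  ext z
  rw [apply_eq]
  simp [sub_apply, smul_apply, ofReal_apply]

/-- The complex-linear extension of a continuous linear map. -/
noncomputable def map (T : X →L[ℝ] X) : NormedComplexification X →L[ℂ] NormedComplexification X :=
  LinearMap.mkContinuous
    { toFun := fun f => T.comp (f : ℂ →L[ℝ] X)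
      map_add' := fun f g => by ext z; exact map_add T _ _
      map_smul' := fun c f => by ext z; rfl } ‖T‖
    fun f => ContinuousLinearMap.opNorm_comp_le T (f : ℂ →L[ℝ] X)

theorem map_pow_apply (T : X →L[ℝ] X) (k : ℕ) (f : NormedComplexification X) (z : ℂ) :
    (map T ^ k) f z = (T ^ k) (f z) := by
  induction k generalizing f with
  | zero => rfl
  | succ k ih => rw [pow_succ, pow_succ]; exact ih (map T f)

theorem map_pow_ofReal (T : X →L[ℝ] X) (k : ℕ) (x : X) :
    (map T ^ k) (ofReal x) = ofReal ((T ^ k) x) := by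
  ext z
  rw [map_pow_apply, ofReal_apply, ofReal_apply, map_smul]

/-- Splitting into real and imaginary parts writes `map T` as a difference of two maps that factor
through `T`. -/
theorem isCompactOperator_map {T : X →L[ℝ] X} (hT : IsCompactOperator T) :
    IsCompactOperator (map T) := by
  have hι : Continuous (ofReal : X → NormedComplexification X) :=
    AddMonoidHomClass.continuous_of_bound ofReal 1 fun x => by simp [norm_ofReal]
  have h : ∀ w : ℂ, IsCompactOperator fun f : NormedComplexification X => ofReal (T (f w)) :=
    fun w => (hT.comp_clm (ContinuousLinearMap.apply ℝ X w)).continuous_comp hι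
  have h2 := (h 1).sub ((h Complex.I).continuous_comp
    (continuous_const_smul (T := NormedComplexification X) Complex.I))
  have heq : (map T : NormedComplexification X → NormedComplexification X) =
      fun f => ofReal (T (f 1)) - Complex.I • ofReal (T (f Complex.I)) :=
    funext fun f => eq_ofReal_sub (map T f)
  rw [heq]
  exact h2

/-- The complex-linear extension of a real functional. -/
noncomputable def extendFunctional (g : X →L[ℝ] ℝ) : NormedComplexification X →ₗ[ℂ] ℂ where
  toFun f := g (f 1) - Complex.I * g (f Complex.I)
  map_add' f h := by simp only [add_apply, map_add, Complex.ofReal_add]; ring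
  map_smul' c f := by
    simp only [smul_apply, RingHom.id_apply]
    rw [apply_eq f (c * 1), apply_eq f (c * Complex.I)]
    apply Complex.ext <;> simp

theorem extendFunctional_apply (g : X →L[ℝ] ℝ) (f : NormedComplexification X) :
    extendFunctional g f = g (f 1) - Complex.I * g (f Complex.I) := rfl

theorem extendFunctional_ofReal (g : X →L[ℝ] ℝ) (x : X) :
    extendFunctional g (ofReal x) = g x := by
  simp [extendFunctional_apply, ofReal_apply]

theorem extendFunctional_eq_zero_iff (g : X →L[ℝ] ℝ) (f : NormedComplexification X) :
    extendFunctional g f = 0 ↔ g (f 1) = 0 ∧ g (f Complex.I) = 0 := by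
  rw [extendFunctional_apply, Complex.ext_iff]
  simp

/-- The crude factor `2` suffices; it becomes `C = 2` in the triangular system, hence the later
powers of `3`. -/
theorem norm_extendFunctional_le (g : X →L[ℝ] ℝ) (f : NormedComplexification X) :
    ‖extendFunctional g f‖ ≤ 2 * ‖g‖ * ‖f‖ := by
  rw [extendFunctional_apply]
  refine (norm_sub_le _ _).trans ?_
  have h : ∀ z : ℂ, ‖z‖ = 1 → ‖g (f z)‖ ≤ ‖g‖ * ‖f‖ := fun z hz =>
    (g.le_opNorm _).trans <| mul_le_mul_of_nonneg_left
      ((norm_apply_le f z).trans (by rw [hz, mul_one])) (norm_nonneg g)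
  have h1 := h 1 (by simp)
  have h2 := h Complex.I (by simp)
  rw [norm_mul, Complex.norm_I, one_mul, Complex.norm_real, Complex.norm_real]
  linarith

/-- The algebraic complexification is isomorphic to the normed one. -/
noncomputable def tensorEquiv : (ℂ ⊗[ℝ] X) ≃ₗ[ℂ] NormedComplexification X where
  __ := (ofReal (X := X)).liftBaseChange ℂ
  invFun f := (1 : ℂ) ⊗ₜ[ℝ] f 1 - Complex.I ⊗ₜ[ℝ] f Complex.I
  left_inv t := by
    change (1 : ℂ) ⊗ₜ[ℝ] ((ofReal (X := X)).liftBaseChange ℂ t) 1 -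
      Complex.I ⊗ₜ[ℝ] ((ofReal (X := X)).liftBaseChange ℂ t) Complex.I = t
    induction t with
    | zero => simp [zero_apply]
    | add a b ha hb =>
      rw [map_add, add_apply, add_apply, TensorProduct.tmul_add, TensorProduct.tmul_add,
        add_sub_add_comm, ha, hb]
    | tmul c x =>
      rw [LinearMap.liftBaseChange_tmul, smul_apply, smul_apply, ofReal_apply, ofReal_apply,
        ← TensorProduct.smul_tmul, ← TensorProduct.smul_tmul, ← TensorProduct.sub_tmul]
      congr 1
      apply Complex.ext <;> simp
  right_inv f := by
    change (ofReal (X := X)).liftBaseChange ℂ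
      ((1 : ℂ) ⊗ₜ[ℝ] f 1 - Complex.I ⊗ₜ[ℝ] f Complex.I) = f
    rw [map_sub, LinearMap.liftBaseChange_tmul, LinearMap.liftBaseChange_tmul, one_smul]
    exact (eq_ofReal_sub f).symm

theorem tensorEquiv_tmul (c : ℂ) (x : X) : tensorEquiv (c ⊗ₜ[ℝ] x) = c • ofReal x :=
  LinearMap.liftBaseChange_tmul ..

theorem tensorEquiv_complexification (T : X →L[ℝ] X) (t : ℂ ⊗[ℝ] X) :
    tensorEquiv (complexification T t) = map T (tensorEquiv t) := by
  induction t with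
  | zero => simp
  | add a b ha hb => simp only [map_add, ha, hb]
  | tmul c x =>
    rw [complexification, LinearMap.baseChange_tmul, tensorEquiv_tmul, tensorEquiv_tmul, map_smul]
    congr 1
    simpa using (map_pow_ofReal T 1 x).symm

end NormedComplexification

theorem Module.End.rank_maxGenEigenspace_eq_of_intertwine {R : Type*} {V W : Type _} [CommRing R]
    [AddCommGroup V] [Module R V] [AddCommGroup W] [Module R W] {f : Module.End R V}
    {g : Module.End R W} (e : V ≃ₗ[R] W) (h : ∀ v, e (f v) = g (e v)) (z : R) :
    Module.rank R (f.maxGenEigenspace z) = Module.rank R (g.maxGenEigenspace z) := by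
  have hsub : ∀ v, e ((f - z • 1) v) = (g - z • 1) (e v) := fun v => by simp [h]
  have hpow : ∀ (k : ℕ) (v : V), e (((f - z • 1) ^ k) v) = ((g - z • 1) ^ k) (e v) := by
    intro k
    induction k with
    | zero => intro v; rfl
    | succ k ih =>
      intro v
      rw [pow_succ, pow_succ, Module.End.mul_apply, Module.End.mul_apply, ih, hsub]
  have hmap : (f.maxGenEigenspace z).map (e : V →ₗ[R] W) = g.maxGenEigenspace z := by
    ext w
    obtain ⟨v, rfl⟩ := e.surjective w
    simp only [Submodule.mem_map_equiv, LinearEquiv.symm_apply_apply, Module.End.mem_maxGenEigenspace,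
      ← hpow, LinearEquiv.map_eq_zero_iff]
  rw [← hmap]
  exact (e.submoduleMap (f.maxGenEigenspace z)).rank_eq

/-- This carries multiplicities from the tensor product to the normed model, where Riesz theory
applies. -/
theorem algMultiplicity_eq_toENat_rank {X : Type*} [NormedAddCommGroup X] [NormedSpace ℝ X]
    (T : X →L[ℝ] X) (z : ℂ) : algMultiplicity T z = Cardinal.toENat (Module.rank ℂ
      (Module.End.maxGenEigenspace
        (NormedComplexification.map T : Module.End ℂ (NormedComplexification X)) z)) := by
  rw [algMultiplicity, Module.End.rank_maxGenEigenspace_eq_of_intertwine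
    NormedComplexification.tensorEquiv (NormedComplexification.tensorEquiv_complexification T) z]

end NormedComplexification

/-! ### Dimension of the span of generalized eigenspaces. -/

section Counting

variable {V : Type*} [AddCommGroup V] [Module ℂ V]

/-- Bases of the generalized eigenspaces for the eigenvalues of modulus at least `s` combine to a
basis of their span. -/
noncomputable def outerGenEigenspaceBasis (f : Module.End ℂ V) (s : ℝ)
    {η : {z : ℂ // s ≤ ‖z‖} → Type*}
    (b : ∀ z, Module.Basis (η z) ℂ (f.maxGenEigenspace (z : ℂ))) :
    Module.Basis (Σ z, η z) ℂ (outerGenEigenspace f s) :=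
  (DFinsupp.basis b).map <|
    (LinearEquiv.ofInjective _ (iSupIndep.dfinsupp_lsum_injective
      (f.independent_maxGenEigenspace.comp Subtype.val_injective))).trans
    (LinearEquiv.ofEq _ _ (Submodule.iSup_eq_range_dfinsupp_lsum _).symm)

theorem finite_and_natCard_eq_finrank_outerGenEigenspace (f : Module.End ℂ V) (s : ℝ)
    [FiniteDimensional ℂ (outerGenEigenspace f s)] {η : {z : ℂ // s ≤ ‖z‖} → Type*}
    (b : ∀ z, Module.Basis (η z) ℂ (f.maxGenEigenspace (z : ℂ))) :
    Finite (Σ z, η z) ∧ Nat.card (Σ z, η z) = Module.finrank ℂ (outerGenEigenspace f s) :=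
  ⟨Module.Finite.finite_basis (outerGenEigenspaceBasis f s b),
    (Module.finrank_eq_nat_card_basis (outerGenEigenspaceBasis f s b)).symm⟩

theorem finiteDimensional_maxGenEigenspace {f : Module.End ℂ V} {s : ℝ}
    [FiniteDimensional ℂ (outerGenEigenspace f s)] {z : ℂ} (hz : s ≤ ‖z‖) :
    FiniteDimensional ℂ (f.maxGenEigenspace z) :=
  Submodule.finiteDimensional_of_le (maxGenEigenspace_le_outerGenEigenspace hz)

end Counting

/-! ### Existence and counting of eigenvalue sequences. -/

section Eigenvalues

variable {X : Type*} [NormedAddCommGroup X] [NormedSpace ℝ X] {T : X →L[ℝ] X}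

/-- The span in the normed complexification of all generalized eigenspaces of `T` for the
eigenvalues of modulus at least `s`. -/
noncomputable abbrev spectralSubspace (T : X →L[ℝ] X) (s : ℝ) :
    Submodule ℂ (NormedComplexification X) :=
  outerGenEigenspace
    (NormedComplexification.map T : Module.End ℂ (NormedComplexification X)) s

theorem finiteDimensional_spectralSubspace (hT : IsCompactOperator T) {s : ℝ} (hs : 0 < s) :
    FiniteDimensional ℂ (spectralSubspace T s) :=
  finiteDimensional_outerGenEigenspace (NormedComplexification.isCompactOperator_map hT) hs

theorem algMultiplicity_eq_finrank (hT : IsCompactOperator T) {z : ℂ} (hz : z ≠ 0) :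
    algMultiplicity T z = Module.finrank ℂ (Module.End.maxGenEigenspace
      (NormedComplexification.map T : Module.End ℂ (NormedComplexification X)) z) := by
  have := finiteDimensional_spectralSubspace hT (norm_pos_iff.2 hz)
  have := finiteDimensional_maxGenEigenspace (f := (NormedComplexification.map T :
    Module.End ℂ (NormedComplexification X))) (le_refl ‖z‖)
  rw [algMultiplicity_eq_toENat_rank, ← Module.finrank_eq_rank, Cardinal.toENat_nat]

theorem IsEigenvalueSequence.finite_and_ncard_eq {μ : ℕ → ℂ} (hμ : IsEigenvalueSequence T μ)
    (hT : IsCompactOperator T) {s : ℝ} (hs : 0 < s) :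
    {n | s ≤ ‖μ n‖}.Finite ∧
      {n | s ≤ ‖μ n‖}.ncard = Module.finrank ℂ (spectralSubspace T s) := by
  have := finiteDimensional_spectralSubspace hT hs
  set f : Module.End ℂ (NormedComplexification X) :=
    (NormedComplexification.map T : Module.End ℂ (NormedComplexification X)) with hf
  -- The indices `n` with `μ n = z` are as many as the multiplicity of `z`, so they can label a
  -- basis.
  have hb : ∀ z : {z : ℂ // s ≤ ‖z‖},
      Nonempty (Module.Basis {n // μ n = z} ℂ (f.maxGenEigenspace (z : ℂ))) := by
    rintro ⟨z, hz⟩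
    have := finiteDimensional_maxGenEigenspace (f := f) hz
    have hz0 : z ≠ 0 := norm_pos_iff.1 (hs.trans_le hz)
    have hcard := hμ.encard_eq z hz0
    rw [algMultiplicity_eq_finrank hT hz0] at hcard
    have hfin : {n | μ n = z}.Finite := Set.finite_of_encard_eq_coe hcard
    have : Finite {n // μ n = z} := hfin
    have hcard' : Nat.card {n // μ n = z} = Module.finrank ℂ (f.maxGenEigenspace z) := by
      rw [← Nat.cast_inj (R := ℕ∞), ← hcard, ← hfin.cast_ncard_eq]
      rfl
    exact ⟨(Module.finBasis ℂ _).reindex (Finite.equivFinOfCardEq hcard').symm⟩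
  obtain ⟨h1, h2⟩ := finite_and_natCard_eq_finrank_outerGenEigenspace f s fun z => (hb z).some
  let e : (Σ z : {z : ℂ // s ≤ ‖z‖}, {n // μ n = z}) ≃ {n | s ≤ ‖μ n‖} :=
    { toFun := fun p => ⟨p.2.1, by rw [Set.mem_ofPred_eq, p.2.2]; exact p.1.2⟩
      invFun := fun n => ⟨⟨μ n, n.2⟩, ⟨n, rfl⟩⟩
      left_inv := by rintro ⟨⟨z, hz⟩, ⟨n, hn⟩⟩; dsimp only at hn; subst hn; rfl
      right_inv := fun n => rfl }
  refine ⟨Set.finite_coe_iff.1 (Finite.of_equiv _ e), ?_⟩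
  rw [← Nat.card_coe_set_eq, ← Nat.card_congr e, h2]

theorem exists_isEigenvalueSequence (hT : IsCompactOperator T) :
    ∃ μ : ℕ → ℂ, IsEigenvalueSequence T μ := by
  set f : Module.End ℂ (NormedComplexification X) :=
    (NormedComplexification.map T : Module.End ℂ (NormedComplexification X)) with hf
  -- Eigenvalues with multiplicity; a `z` that is no eigenvalue contributes `Fin 0`.
  let ι := Σ z : {z : ℂ // z ≠ 0}, Fin (Module.finrank ℂ (f.maxGenEigenspace (z : ℂ)))
  have hfin : ∀ s : ℝ, 0 < s → {i : ι | s ≤ ‖(i.1 : ℂ)‖}.Finite := by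
    intro s hs
    have := finiteDimensional_spectralSubspace hT hs
    have hfd : ∀ z : {z : ℂ // s ≤ ‖z‖}, FiniteDimensional ℂ (f.maxGenEigenspace (z : ℂ)) :=
      fun z => finiteDimensional_maxGenEigenspace z.2
    have := (finite_and_natCard_eq_finrank_outerGenEigenspace f s
      fun z => Module.finBasis ℂ (f.maxGenEigenspace (z : ℂ))).1
    let e : {i : ι | s ≤ ‖(i.1 : ℂ)‖} →
        Σ z : {z : ℂ // s ≤ ‖z‖}, Fin (Module.finrank ℂ (f.maxGenEigenspace (z : ℂ))) :=
      fun i => ⟨⟨i.1.1, i.2⟩, i.1.2⟩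
    refine Set.finite_coe_iff.1 (Finite.of_injective e ?_)
    rintro ⟨⟨⟨z, hz⟩, a⟩, ha⟩ ⟨⟨⟨w, hw⟩, b⟩, hb⟩ h
    simp only [e, Sigma.mk.injEq, Subtype.mk.injEq] at h
    obtain ⟨rfl, h⟩ := h
    rw [eq_of_heq h]
  obtain ⟨r, hr, hmono, hlower⟩ := exists_decreasing_enumeration (fun i : ι => ‖(i.1 : ℂ)‖)
    (fun i => norm_pos_iff.2 i.1.2) hfin
  classical
  let μ : ℕ → ℂ := fun n => if h : ∃ i, r i = n then (h.choose.1 : ℂ) else 0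
  have hμr : ∀ i, μ (r i) = i.1 := fun i => by
    have h : ∃ j, r j = r i := ⟨i, rfl⟩
    simp only [μ, dif_pos h, hr h.choose_spec]
  have hμ0 : ∀ n, (¬ ∃ i, r i = n) → μ n = 0 := fun n h => dif_neg h
  refine ⟨μ, fun m n hmn => ?_, fun z hz => ?_⟩
  · by_cases hn : ∃ i, r i = n
    · obtain ⟨j, rfl⟩ := hn
      obtain ⟨i, rfl⟩ : ∃ i, r i = m := by
        rcases hmn.lt_or_eq with h | h
        · exact hlower j m h
        · exact ⟨j, h.symm⟩
      simp only [hμr]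
      exact hmono i j hmn
    · simp only [hμ0 n hn, norm_zero]
      exact norm_nonneg _
  · have hset : {n | μ n = z} = Set.range fun a => r ⟨⟨z, hz⟩, a⟩ := by
      ext n
      constructor
      · intro hn
        by_cases h : ∃ i, r i = n
        · obtain ⟨⟨⟨w, hw⟩, a⟩, rfl⟩ := h
          obtain rfl : w = z := (hμr _).symm.trans hn
          exact ⟨a, rfl⟩
        · exact absurd ((hμ0 n h).symm.trans hn).symm hz
      · rintro ⟨a, rfl⟩
        exact hμr _
    have hinj : Function.Injective fun a => r ⟨⟨z, hz⟩, a⟩ :=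
      hr.comp sigma_mk_injective
    rw [hset, ← Set.image_univ, hinj.encard_image, algMultiplicity_eq_finrank hT hz]
    simp [f]

end Eigenvalues

/-! ### Comparing `j`-eigenvalues of powers with spectral subspaces. -/

section Comparison

variable {X : Type*} [NormedAddCommGroup X] [NormedSpace ℝ X] {T : X →L[ℝ] X}

open NormedComplexification

/-- If the image of every vector under `T ^ k` is close to `E`, then the `j`-eigenvalues of `T ^ k`
from the index `dim E` on are small. -/
theorem IsJEigenSequence.le_of_forall_exists_norm_sub_le (hX : IsUniformlySmooth X) {k : ℕ}
    {x : ℕ → X} {lam : ℕ → ℝ} (h : IsJEigenSequence (T ^ k) x lam)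
    {E : Submodule ℂ (NormedComplexification X)} [FiniteDimensional ℂ E] {n : ℕ}
    (hE : Module.finrank ℂ E ≤ n) {c : ℝ}
    (hc : ∀ v, ∃ e ∈ E, ‖(NormedComplexification.map T ^ k) v - e‖ ≤ c * ‖v‖) : lam n ≤ 3 ^ (n + 1) * c := by
  choose g hg1 hgi hgz using h.exists_norming hX
  let y : ℕ → NormedComplexification X := fun i => ofReal ((lam i)⁻¹ • (T ^ k) (x i))
  obtain ⟨i, hi, hdist⟩ := exists_forall_le_norm_sub_of_triangular (y := y)
    (g := fun i => extendFunctional (g i)) (C := 2) (by norm_num)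
    (fun i v => by simpa [hg1] using norm_extendFunctional_le (g i) v)
    (fun i => (norm_ofReal _).trans_le (by
      rw [norm_smul, h.norm_apply, norm_inv, Real.norm_of_nonneg (h.pos i).le,
        inv_mul_cancel₀ (h.ne_zero i)]))
    (fun i => by
      rw [extendFunctional_ofReal, map_smul, hgi, smul_eq_mul, inv_mul_cancel₀ (h.ne_zero i),
        Complex.ofReal_one])
    (fun i j hij => by
      rw [extendFunctional_ofReal, map_smul, hgz i j hij, smul_zero, Complex.ofReal_zero]) hE
  have hpos := h.pos i
  -- The vector `y i` is the image of a vector of norm `(lam i)⁻¹`, so its distance to `E` is at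
  -- most `c / lam i`.
  obtain ⟨e, he, hec⟩ := hc (ofReal ((lam i)⁻¹ • x i))
  rw [map_pow_ofReal, map_smul] at hec
  have h1 := (hdist e he).trans hec
  rw [norm_ofReal, norm_smul, h.norm_eq_one, mul_one, norm_inv, Real.norm_of_nonneg hpos.le,
    ← div_eq_mul_inv, le_div_iff₀ hpos, inv_mul_le_iff₀ (by positivity)] at h1
  norm_num at h1
  exact (h.antitone hi).trans h1

/-- If the powers of `T` are bounded below on a subspace of dimension greater than `n`, so are the
`j`-eigenvalues with index `n`. -/
theorem IsJEigenSequence.le_of_forall_le_norm {k : ℕ} {x : ℕ → X} {lam : ℕ → ℝ}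
    (h : IsJEigenSequence (T ^ k) x lam) {E : Submodule ℂ (NormedComplexification X)}
    [FiniteDimensional ℂ E] {n : ℕ} (hE : n < Module.finrank ℂ E) {c : ℝ}
    (hc : ∀ v ∈ E, c * ‖v‖ ≤ ‖(NormedComplexification.map T ^ k) v‖) : c ≤ 2 * lam n := by
  -- A kernel vector of `F` has both its values at `1` and at `I` in `jSubspace x n`; adding the two
  -- estimates gives the factor `2`.
  let F : E →ₗ[ℂ] (Fin n → ℂ) :=
    LinearMap.pi fun i => (extendFunctional (normGrad (x i))).comp E.subtype
  obtain ⟨v, hv, hv0⟩ := (Submodule.ne_bot_iff _).1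
    (LinearMap.ker_ne_bot_of_finrank_lt (f := F) (by simpa using hE))
  have hvi : ∀ i < n, normGrad (x i) ((v : NormedComplexification X) 1) = 0 ∧
      normGrad (x i) ((v : NormedComplexification X) Complex.I) = 0 := fun i hi =>
    (extendFunctional_eq_zero_iff _ _).1 (congrFun (LinearMap.mem_ker.1 hv) ⟨i, hi⟩)
  have hpos : 0 < ‖(v : NormedComplexification X)‖ :=
    norm_pos_iff.2 fun h0 => hv0 (Subtype.ext h0)
  have h1 := h.norm_apply_le (n := n) (z := (v : NormedComplexification X) 1)
    fun i hi => (hvi i hi).1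
  have h2 := h.norm_apply_le (n := n) (z := (v : NormedComplexification X) Complex.I)
    fun i hi => (hvi i hi).2
  have h3 := norm_le_add ((NormedComplexification.map T ^ k) (v : NormedComplexification X))
  rw [map_pow_apply, map_pow_apply] at h3
  have h4 := NormedComplexification.norm_apply_le (v : NormedComplexification X) 1
  have h5 := NormedComplexification.norm_apply_le (v : NormedComplexification X) Complex.I
  rw [norm_one, mul_one] at h4
  rw [Complex.norm_I, mul_one] at h5
  have h6 := mul_le_mul_of_nonneg_left h4 (h.pos n).le
  have h7 := mul_le_mul_of_nonneg_left h5 (h.pos n).le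
  have h8 := hc v v.2
  refine le_of_mul_le_mul_right ?_ hpos
  linarith

end Comparison

theorem mainTheorem4 {X : Type*} [NormedAddCommGroup X] [NormedSpace ℝ X] [CompleteSpace X]
    [UniformConvexSpace X] (hsmooth : IsUniformlySmooth X) (hdim : ¬ FiniteDimensional ℝ X)
    (T : X →L[ℝ] X) (hcompact : IsCompactOperator T)
    (hker : ∀ x : X, T x = 0 → x = 0) (hrange : DenseRange T) :
    (∃ μ : ℕ → ℂ, IsEigenvalueSequence T μ) ∧
    (∀ k : ℕ, 1 ≤ k → ∃ (x : ℕ → X) (lam : ℕ → ℝ), IsJEigenSequence (T ^ k) x lam) ∧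
    ∀ μ : ℕ → ℂ, IsEigenvalueSequence T μ →
      ∀ (x : ℕ → ℕ → X) (lam : ℕ → ℕ → ℝ),
        (∀ k : ℕ, 1 ≤ k → IsJEigenSequence (T ^ k) (x k) (lam k)) →
        ∀ n : ℕ, Tendsto (fun k : ℕ => lam k n ^ (1 / (k : ℝ))) atTop (𝓝 ‖μ n‖) := by
  have hK := NormedComplexification.isCompactOperator_map hcompact
  refine ⟨exists_isEigenvalueSequence hcompact, fun k hk => ?_, fun μ hμ x lam hlam n => ?_⟩
  · refine exists_isJEigenSequence hdim ?_ ?_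
    · obtain ⟨m, rfl⟩ := Nat.exists_eq_add_of_le' hk
      rw [pow_succ']
      exact hcompact.comp_clm (T ^ m)
    · clear hk
      induction k with
      | zero => exact fun x hx => hx
      | succ k ih =>
        intro x hx
        rw [pow_succ] at hx
        exact hker x (ih (T x) hx)
  -- The constant comes from the upper bound; the lower one needs only `2`.
  · refine tendsto_rpow_one_div_of_eventually_le (A := 2 * 3 ^ (n + 1)) ?_ (norm_nonneg _)
      (by positivity) (fun s hs => ?_) (fun s hs0 hs => ?_)
    · filter_upwards [eventually_ge_atTop 1] with k hk
      exact ((hlam k hk).pos n).le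
    -- A level strictly above `‖μ n‖` leaves only indices below `n`; the gap up to `s` is used by
    -- Gelfand's formula.
    · obtain ⟨s', hμs', hs's⟩ := exists_between hs
      have hs'0 : 0 < s' := (norm_nonneg _).trans_lt hμs'
      have := finiteDimensional_spectralSubspace hcompact hs'0
      have hle : Module.finrank ℂ (spectralSubspace T s') ≤ n := by
        rw [← (hμ.finite_and_ncard_eq hcompact hs'0).2]
        refine (Set.ncard_le_ncard (t := Set.Iio n) ?_ (Set.finite_Iio n)).trans (by simp)
        intro m hm
        by_contra! hnm
        exact absurd (hm.trans (hμ.antitone_norm (not_lt.1 hnm))) (not_le.2 hμs')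
      filter_upwards [eventually_exists_norm_pow_sub_le hK hs'0 hs's, eventually_ge_atTop 1]
        with k h1 hk
      have := (hlam k hk).le_of_forall_exists_norm_sub_le hsmooth hle h1
      linarith
    · have hμ0 : 0 < ‖μ n‖ := hs0.trans hs
      have := finiteDimensional_spectralSubspace hcompact hμ0
      obtain ⟨hfin, hcard⟩ := hμ.finite_and_ncard_eq hcompact hμ0
      -- At the level `‖μ n‖` itself all the `n + 1` indices `0, …, n` are counted.
      have hlt : n < Module.finrank ℂ (spectralSubspace T ‖μ n‖) := by
        rw [← hcard]
        have h1 : (Set.Iic n).ncard ≤ {m | ‖μ n‖ ≤ ‖μ m‖}.ncard :=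
          Set.ncard_le_ncard (fun m hm => hμ.antitone_norm hm) hfin
        rw [Set.ncard_Iic_nat] at h1
        omega
      filter_upwards [eventually_pow_mul_norm_le (K := NormedComplexification.map T) hs0 hs,
        eventually_ge_atTop 1] with k h1 hk
      have h2 := (hlam k hk).le_of_forall_le_norm hlt h1
      have h3 : (1 : ℝ) ≤ 3 ^ (n + 1) := one_le_pow₀ (by norm_num)
      nlinarith [(hlam k hk).pos n]
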